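/- Let $X$ be a set equipped with a $\sigma$-algebra $\mathcal O(X)$, and let $\mathcal H$ be a separable complex Hilbert space with inner product linear in the second variable. A positive operator valued measure (POVM) on $X$ is a map $\mu:\mathcal O(X)\to\mathcal B(\mathcal H)$ such that $\mu(A)\ge 0$ for every $A\in\mathcal O(X)$ and such that $A\mapsto\langle h,\mu(A)k\rangle$ is a complex measure for all $h,k\in\mathcal H$; it is normalized if $\mu(X)=I_{\mathcal H}$. A normalized POVM $\mu$ is called $C^*$-extreme if, whenever $\mu(A)=\sum_{i=1}^n T_i^*\mu_i(A)T_i$ for all $A\in\mathcal O(X)$, where $\mu_1,\dots,\mu_n$ are normalized POVMs on $X$ with values in $\mathcal B(\mathcal H)$ and $T_1,\dots,T_n\in\mathcal B(\mathcal H)$ are invertible with $\sum_{i=1}^n T_i^*T_i=I_{\mathcal H}$, there are unitary operators $U_1,\dots,U_n\in\mathcal B(\mathcal H)$ such that $\mu_i(A)=U_i^*\mu(A)U_i$ for all $A\in\mathcal O(X)$ and $1\le i\le n$. Let $\mu$ be a $C^*$-extreme normalized POVM on $X$ with values in $\mathcal B(\mathcal H)$. If $E\in\mathcal O(X)$ is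 such that $\mu(A)\mu(E)=\mu(E)\mu(A)$ for all $A\in\mathcal O(X)$ with $A\subseteq E$, then $\mu(E)$ is an (orthogonal) projection. In particular, if $E\in\mathcal O(X)$ is such that $\mu(E)$ commutes with $\mu(B)$ for all $B\in\mathcal O(X)$, then $\mu(E)$ is a projection. -/

import Mathlib

open MeasureTheory ContinuousLinearMap

/-- A positive operator valued measure on the measurable space `X` with values in the bounded
operators on `H`. Only the values on measurable sets are meaningful: every notion below looks at
measurable sets alone. Mathlib's inner product is linear in the second variable. -/
structure POVM (X : Type*) [MeasurableSpace X] (H : Type*) [NormedAddCommGroup H]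
    [InnerProductSpace ℂ H] [CompleteSpace H] where
  toFun : Set X → H →L[ℂ] H
  isPositive' : ∀ A : Set X, MeasurableSet A → (toFun A).IsPositive
  isComplexMeasure' : ∀ h k : H, ∃ m : ComplexMeasure X,
    ∀ A : Set X, MeasurableSet A → m A = inner ℂ h (toFun A k)

namespace POVM

instance {X : Type*} [MeasurableSpace X] {H : Type*} [NormedAddCommGroup H]
    [InnerProductSpace ℂ H] [CompleteSpace H] :
    CoeFun (POVM X H) (fun _ => Set X → H →L[ℂ] H) := ⟨POVM.toFun⟩

/-- `μ(X)` is the identity operator. -/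
def IsNormalized {X : Type*} [MeasurableSpace X] {H : Type*} [NormedAddCommGroup H]
    [InnerProductSpace ℂ H] [CompleteSpace H] (μ : POVM X H) : Prop :=
  μ Set.univ = 1

/-- `μ = ∑ i, (T i)* (ν i)(·) (T i)` is a proper `C*`-convex combination: the `ν i` are normalized
POVMs and the coefficients `T i` are invertible with `∑ i, (T i)* (T i) = 1`. -/
structure IsProperCStarCombination {X : Type*} [MeasurableSpace X] {H : Type*}
    [NormedAddCommGroup H] [InnerProductSpace ℂ H] [CompleteSpace H] (μ : POVM X H)
    {n : ℕ} (T : Fin n → H →L[ℂ] H) (ν : Fin n → POVM X H) : Prop where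
  isNormalized : ∀ i, (ν i).IsNormalized
  isUnit : ∀ i, IsUnit (T i)
  sum_eq_one : ∑ i, adjoint (T i) * T i = 1
  eq_sum : ∀ A : Set X, MeasurableSet A → μ A = ∑ i, adjoint (T i) * ν i A * T i

/-- `ν(·) = U* μ(·) U` for some unitary `U` on `H`. -/
def UnitarilyEquivalent {X : Type*} [MeasurableSpace X] {H : Type*} [NormedAddCommGroup H]
    [InnerProductSpace ℂ H] [CompleteSpace H] (ν μ : POVM X H) : Prop :=
  ∃ U ∈ unitary (H →L[ℂ] H), ∀ A : Set X, MeasurableSet A → ν A = adjoint U * μ A * U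

/-- `μ` is a `C*`-extreme point of the set of normalized POVMs: it is normalized, and all the
POVMs in a proper `C*`-convex combination for `μ` are unitarily equivalent to `μ`. -/
structure IsCStarExtreme {X : Type*} [MeasurableSpace X] {H : Type*} [NormedAddCommGroup H]
    [InnerProductSpace ℂ H] [CompleteSpace H] (μ : POVM X H) : Prop where
  isNormalized : μ.IsNormalized
  unitarilyEquivalent : ∀ (n : ℕ) (T : Fin n → H →L[ℂ] H) (ν : Fin n → POVM X H),
    μ.IsProperCStarCombination T ν → ∀ i, (ν i).UnitarilyEquivalent μ

end POVM

/-! Let `M = μ E`, and suppose its spectrum contains `t₀` with `0 < t₀ < 1`. For continuous `ψ` with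
`|ψ| ≤ 1/2`, reweighting `μ` on `E` by `1 + ψ(M)` and renormalizing gives a POVM; commutation makes
`μ` a proper `C*`-combination of those for `ψ` and `-ψ` (`isProperCStarCombination_perturb`).
Extremality then makes `M` unitarily equivalent to `g(M)`, where `g t = t (1 + ψ t) / (1 + t ψ t)`.
Any `c` close to `t₀` is the constant value of such a `g` near `t₀` (`exists_perturbation`), hence
an eigenvalue of `g(M)`, hence of `M` (`exists_eigenvector`). So `M` has an interval of eigenvalues,
which separability forbids. -/

/-- A self-adjoint operator on a separable Hilbert space has at most countably many eigenvalues. -/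
theorem IsSelfAdjoint.countable_setOf_eigenvalue {H : Type*} [NormedAddCommGroup H]
    [InnerProductSpace ℂ H] [CompleteSpace H] [TopologicalSpace.SeparableSpace H]
    {M : H →L[ℂ] H} (hM : IsSelfAdjoint M) :
    {c : ℝ | ∃ v : H, v ≠ 0 ∧ M v = (c : ℂ) • v}.Countable := by
  have key : ∀ c ∈ {c : ℝ | ∃ v : H, v ≠ 0 ∧ M v = (c : ℂ) • v},
      ∃ v : H, ‖v‖ = 1 ∧ M v = (c : ℂ) • v := by
    rintro c ⟨v, hv, h⟩
    refine ⟨((‖v‖ : ℂ))⁻¹ • v, ?_, ?_⟩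
    · have := norm_ne_zero_iff.2 hv
      simp [norm_smul, this]
    · rw [map_smul, h, smul_comm]
  choose! v hv hMv using key
  -- Unit eigenvectors for distinct eigenvalues are orthogonal, so at distance `√2 > 1`: balls of
  -- radius `1/2` are disjoint.
  refine Set.PairwiseDisjoint.countable_of_isOpen (s := fun c => Metric.ball (v c) (1 / 2)) ?_
    (fun c _ => Metric.isOpen_ball) (fun c _ => ⟨v c, Metric.mem_ball_self (by norm_num)⟩)
  intro c hc d hd hcd
  refine Metric.ball_disjoint_ball ?_
  have horth : inner ℂ (v c) (v d) = 0 := by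
    have h := hM.isSymmetric (v c) (v d)
    simp only [ContinuousLinearMap.coe_coe] at h
    rw [hMv c hc, hMv d hd, inner_smul_left, inner_smul_right, Complex.conj_ofReal] at h
    by_contra h0
    exact hcd (by exact_mod_cast mul_right_cancel₀ h0 h)
  have h2 := @norm_sub_mul_self ℂ H _ _ _ (v c) (v d)
  rw [horth, hv c hc, hv d hd] at h2
  rw [dist_eq_norm]
  simp only [map_zero] at h2
  nlinarith [norm_nonneg (v c - v d)]

namespace POVM

variable {X : Type*} [MeasurableSpace X] {H : Type*} [NormedAddCommGroup H]
  [InnerProductSpace ℂ H] [CompleteSpace H]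

theorem apply_empty (μ : POVM X H) : μ ∅ = 0 := by
  refine ContinuousLinearMap.ext fun k => ext_inner_left ℂ fun h => ?_
  obtain ⟨m, hm⟩ := μ.isComplexMeasure' h k
  rw [← hm ∅ .empty, m.empty, zero_apply, inner_zero_right]

theorem apply_inter_add_inter_compl (μ : POVM X H) {A E : Set X} (hA : MeasurableSet A)
    (hE : MeasurableSet E) : μ (A ∩ E) + μ (A ∩ Eᶜ) = μ A := by
  refine ContinuousLinearMap.ext fun k => ext_inner_left ℂ fun h => ?_
  obtain ⟨m, hm⟩ := μ.isComplexMeasure' h k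
  rw [add_apply, inner_add_right, ← hm _ (hA.inter hE),
    ← hm _ (hA.inter hE.compl), ← hm A hA, ← m.of_union _ (hA.inter hE) (hA.inter hE.compl),
    Set.inter_union_compl]
  exact Set.disjoint_left.2 fun x hx hx' => hx'.2 hx.2

/-- The POVM that compresses `μ` by `r` on `E` and by `s` on the complement of `E`. -/
noncomputable def glue (μ : POVM X H) {E : Set X} (hE : MeasurableSet E) (r s : H →L[ℂ] H) : POVM X H where
  toFun A := adjoint r * μ (A ∩ E) * r + adjoint s * μ (A ∩ Eᶜ) * s
  isPositive' A hA := by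
    simpa only [ContinuousLinearMap.mul_def, ContinuousLinearMap.comp_assoc] using
      ((μ.isPositive' _ (hA.inter hE)).adjoint_conj r).add
        ((μ.isPositive' _ (hA.inter hE.compl)).adjoint_conj s)
  isComplexMeasure' h k := by
    obtain ⟨m, hm⟩ := μ.isComplexMeasure' (r h) (r k)
    obtain ⟨m', hm'⟩ := μ.isComplexMeasure' (s h) (s k)
    refine ⟨m.restrict E + m'.restrict Eᶜ, fun A hA => ?_⟩
    rw [add_apply, VectorMeasure.restrict_apply _ hE hA,
      VectorMeasure.restrict_apply _ hE.compl hA, hm _ (hA.inter hE), hm' _ (hA.inter hE.compl)]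
    simp [ContinuousLinearMap.adjoint_inner_right]

theorem glue_apply (μ : POVM X H) {E : Set X} (hE : MeasurableSet E) (r s : H →L[ℂ] H)
    (A : Set X) :
    μ.glue hE r s A = adjoint r * μ (A ∩ E) * r + adjoint s * μ (A ∩ Eᶜ) * s := rfl

theorem isSelfAdjoint (μ : POVM X H) {E : Set X} (hE : MeasurableSet E) :
    IsSelfAdjoint (μ E) :=
  (μ.isPositive' E hE).isSelfAdjoint

theorem spectrum_subset (μ : POVM X H) (hμ : μ.IsNormalized) {E : Set X}
    (hE : MeasurableSet E) : spectrum ℝ (μ E) ⊆ Set.Icc 0 1 := by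
  have h0 : 0 ≤ μ E := (ContinuousLinearMap.nonneg_iff_isPositive _).2 (μ.isPositive' E hE)
  have h1 : μ E ≤ algebraMap ℝ _ 1 := by
    have h := μ.apply_inter_add_inter_compl .univ hE
    rw [Set.univ_inter, Set.univ_inter, hμ] at h
    rw [map_one, ← h]
    exact le_add_of_nonneg_right
      ((ContinuousLinearMap.nonneg_iff_isPositive _).2 (μ.isPositive' _ hE.compl))
  exact fun x hx => ⟨spectrum_nonneg_of_nonneg h0 hx,
    (le_algebraMap_iff_spectrum_le (ha := μ.isSelfAdjoint hE)).1 h1 x hx⟩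

/-! ### Perturbing `μ` by functions of `μ E` -/

section perturbation

variable {ψ : ℝ → ℝ}

theorem one_add_mul_pos (hψ : ∀ t, |ψ t| ≤ 1 / 2) {t : ℝ} (ht : t ∈ Set.Icc (0 : ℝ) 1) :
    0 < 1 + t * ψ t := by
  have := abs_le.1 (hψ t)
  nlinarith [ht.1, ht.2]

theorem one_add_pos (hψ : ∀ t, |ψ t| ≤ 1 / 2) (t : ℝ) : 0 < 1 + ψ t := by
  have := abs_le.1 (hψ t)
  linarith

/-- The coefficient `√((1 + M ψ(M)) / 2)`, where `M = μ E`. -/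
noncomputable def coeff (μ : POVM X H) (E : Set X) (ψ : ℝ → ℝ) : H →L[ℂ] H :=
  cfc (fun t => √((1 + t * ψ t) / 2)) (μ E)

/-- The operator `√((1 + ψ(M)) / (1 + M ψ(M)))`, where `M = μ E`. -/
noncomputable def innerWeight (μ : POVM X H) (E : Set X) (ψ : ℝ → ℝ) : H →L[ℂ] H :=
  cfc (fun t => √(1 + ψ t) * (√(1 + t * ψ t))⁻¹) (μ E)

/-- The operator `1 / √(1 + M ψ(M))`, where `M = μ E`. -/
noncomputable def outerWeight (μ : POVM X H) (E : Set X) (ψ : ℝ → ℝ) : H →L[ℂ] H :=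
  cfc (fun t => (√(1 + t * ψ t))⁻¹) (μ E)

/-- The POVM obtained from `μ` by moving mass between `E` and its complement, as prescribed by
the function `ψ` of `μ E`. -/
noncomputable def perturb (μ : POVM X H) {E : Set X} (hE : MeasurableSet E) (ψ : ℝ → ℝ) :
    POVM X H :=
  μ.glue hE (μ.innerWeight E ψ) (μ.outerWeight E ψ)

theorem adjoint_cfc (f : ℝ → ℝ) (M : H →L[ℂ] H) : adjoint (cfc f M) = cfc f M :=
  (cfc_predicate f M : IsSelfAdjoint _).star_eq

theorem continuousOn_inv_sqrt (μ : POVM X H) (hμ : μ.IsNormalized) {E : Set X}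
    (hE : MeasurableSet E) (hc : Continuous ψ) (hψ : ∀ t, |ψ t| ≤ 1 / 2) :
    ContinuousOn (fun t => (√(1 + t * ψ t))⁻¹) (spectrum ℝ (μ E)) :=
  ContinuousOn.inv₀ (by fun_prop) fun _ ht =>
    (Real.sqrt_pos.2 (one_add_mul_pos hψ (μ.spectrum_subset hμ hE ht))).ne'

theorem adjoint_coeff_mul_coeff (μ : POVM X H) (hμ : μ.IsNormalized) {E : Set X}
    (hE : MeasurableSet E) (hc : Continuous ψ) (hψ : ∀ t, |ψ t| ≤ 1 / 2) :
    adjoint (μ.coeff E ψ) * μ.coeff E ψ = cfc (fun t => (1 + t * ψ t) / 2) (μ E) := by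
  rw [coeff, adjoint_cfc, ← cfc_mul _ _ _ (by fun_prop) (by fun_prop)]
  refine cfc_congr fun t ht => ?_
  have := one_add_mul_pos hψ (μ.spectrum_subset hμ hE ht)
  exact Real.mul_self_sqrt (by positivity)

theorem isUnit_coeff (μ : POVM X H) (hμ : μ.IsNormalized) {E : Set X}
    (hE : MeasurableSet E) (hc : Continuous ψ) (hψ : ∀ t, |ψ t| ≤ 1 / 2) :
    IsUnit (μ.coeff E ψ) := by
  rw [coeff, isUnit_cfc_iff _ _ (by fun_prop) (μ.isSelfAdjoint hE)]
  intro t ht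
  have := one_add_mul_pos hψ (μ.spectrum_subset hμ hE ht)
  positivity

theorem innerWeight_mul_coeff (μ : POVM X H) (hμ : μ.IsNormalized) {E : Set X}
    (hE : MeasurableSet E) (hc : Continuous ψ) (hψ : ∀ t, |ψ t| ≤ 1 / 2) :
    μ.innerWeight E ψ * μ.coeff E ψ = cfc (fun t => √((1 + ψ t) / 2)) (μ E) := by
  have hi := μ.continuousOn_inv_sqrt hμ hE hc hψ
  rw [innerWeight, coeff, ← cfc_mul _ _ _ (by fun_prop) (by fun_prop)]
  refine cfc_congr fun t ht => ?_
  have h := one_add_mul_pos hψ (μ.spectrum_subset hμ hE ht)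
  have h' := one_add_pos hψ t
  have := Real.sqrt_pos.2 h
  simp only [Real.sqrt_div h.le, Real.sqrt_div h'.le]
  generalize √(1 + t * ψ t) = d at this ⊢
  field_simp

/-- The product is scalar, so off `E` no commutation with `μ E` is needed. -/
theorem outerWeight_mul_coeff (μ : POVM X H) (hμ : μ.IsNormalized) {E : Set X}
    (hE : MeasurableSet E) (hc : Continuous ψ) (hψ : ∀ t, |ψ t| ≤ 1 / 2) :
    μ.outerWeight E ψ * μ.coeff E ψ = algebraMap ℝ _ (√2)⁻¹ := by
  have hi := μ.continuousOn_inv_sqrt hμ hE hc hψ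
  rw [outerWeight, coeff, ← cfc_mul _ _ _ (by fun_prop) (by fun_prop),
    ← cfc_const _ (μ E) (μ.isSelfAdjoint hE)]
  refine cfc_congr fun t ht => ?_
  have h := one_add_mul_pos hψ (μ.spectrum_subset hμ hE ht)
  have := Real.sqrt_pos.2 h
  simp only [Real.sqrt_div h.le]
  generalize √(1 + t * ψ t) = d at this ⊢
  field_simp

theorem perturb_apply_self (μ : POVM X H) (hμ : μ.IsNormalized) {E : Set X}
    (hE : MeasurableSet E) (hc : Continuous ψ) (hψ : ∀ t, |ψ t| ≤ 1 / 2) :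
    μ.perturb hE ψ E = cfc (fun t => t * (1 + ψ t) / (1 + t * ψ t)) (μ E) := by
  have hi := μ.continuousOn_inv_sqrt hμ hE hc hψ
  rw [perturb, glue_apply, Set.inter_self, Set.inter_compl_self, apply_empty, mul_zero, zero_mul,
    add_zero, innerWeight, adjoint_cfc]
  nth_rw 2 [← cfc_id' ℝ (μ E) (μ.isSelfAdjoint hE)]
  rw [← cfc_mul _ _ _ (by fun_prop) (by fun_prop), ← cfc_mul _ _ _ (by fun_prop) (by fun_prop)]
  refine cfc_congr fun t ht => ?_
  have h := one_add_mul_pos hψ (μ.spectrum_subset hμ hE ht)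
  have h' := one_add_pos hψ t
  have h1 := Real.sq_sqrt h.le
  have h2 := Real.sq_sqrt h'.le
  have := Real.sqrt_pos.2 h
  generalize √(1 + t * ψ t) = d at this h1 ⊢
  generalize √(1 + ψ t) = e at h2 ⊢
  rw [← h1, ← h2]
  field_simp

/-- With `μ Eᶜ = 1 - M`, this is `t (1 + ψ t) + (1 - t) = 1 + t ψ t` on the spectrum. -/
theorem isNormalized_perturb (μ : POVM X H) (hμ : μ.IsNormalized) {E : Set X}
    (hE : MeasurableSet E) (hc : Continuous ψ) (hψ : ∀ t, |ψ t| ≤ 1 / 2) :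
    (μ.perturb hE ψ).IsNormalized := by
  have hi := μ.continuousOn_inv_sqrt hμ hE hc hψ
  have hEc : μ Eᶜ = cfc (fun t : ℝ => 1 - t) (μ E) := by
    have h := μ.apply_inter_add_inter_compl .univ hE
    rw [Set.univ_inter, Set.univ_inter, hμ] at h
    rw [cfc_sub _ _ _ (by fun_prop) (by fun_prop), cfc_id' ℝ (μ E) (μ.isSelfAdjoint hE),
      cfc_const_one ℝ (μ E) (μ.isSelfAdjoint hE), ← h, add_sub_cancel_left]
  rw [IsNormalized, perturb, glue_apply, Set.univ_inter, Set.univ_inter, hEc, innerWeight,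
    outerWeight, adjoint_cfc, adjoint_cfc]
  nth_rw 2 [← cfc_id' ℝ (μ E) (μ.isSelfAdjoint hE)]
  rw [← cfc_mul _ _ _ (by fun_prop) (by fun_prop), ← cfc_mul _ _ _ (by fun_prop) (by fun_prop),
    ← cfc_mul _ _ _ (by fun_prop) (by fun_prop), ← cfc_mul _ _ _ (by fun_prop) (by fun_prop),
    ← cfc_add _ _ _ (by fun_prop) (by fun_prop), ← cfc_const_one ℝ (μ E) (μ.isSelfAdjoint hE)]
  refine cfc_congr fun t ht => ?_
  have h := one_add_mul_pos hψ (μ.spectrum_subset hμ hE ht)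
  have h' := one_add_pos hψ t
  have h1 := Real.sq_sqrt h.le
  have h2 := Real.sq_sqrt h'.le
  have := Real.sqrt_pos.2 h
  generalize √(1 + t * ψ t) = d at this h1 ⊢
  generalize √(1 + ψ t) = e at h2 ⊢
  field_simp
  linear_combination t * h2 - h1

/-- The renormalization cancels. Commutation with `M` lets the two factors `√((1 + ψ(M)) / 2)` meet
on one side of `μ (A ∩ E)`. -/
theorem adjoint_coeff_mul_perturb_mul_coeff (μ : POVM X H) (hμ : μ.IsNormalized) {E : Set X}
    (hE : MeasurableSet E)
    (hcomm : ∀ A : Set X, MeasurableSet A → A ⊆ E → Commute (μ A) (μ E))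
    (hc : Continuous ψ) (hψ : ∀ t, |ψ t| ≤ 1 / 2) {A : Set X} (hA : MeasurableSet A) :
    adjoint (μ.coeff E ψ) * μ.perturb hE ψ A * μ.coeff E ψ =
      cfc (fun t => (1 + ψ t) / 2) (μ E) * μ (A ∩ E) + (1 / 2 : ℝ) • μ (A ∩ Eᶜ) := by
  have hin := μ.innerWeight_mul_coeff hμ hE hc hψ
  have hout := μ.outerWeight_mul_coeff hμ hE hc hψ
  have hin' := congrArg star hin
  have hout' := congrArg star hout
  rw [star_mul, (cfc_predicate _ _ : IsSelfAdjoint (cfc (fun t => √((1 + ψ t) / 2)) (μ E))).star_eq]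
    at hin'
  rw [star_mul, ← algebraMap_star_comm, star_trivial (√2)⁻¹] at hout'
  have hcm : Commute (cfc (fun t => √((1 + ψ t) / 2)) (μ E)) (μ (A ∩ E)) :=
    (hcomm _ (hA.inter hE) Set.inter_subset_right).symm.cfc_real _
  have hsq : cfc (fun t => √((1 + ψ t) / 2)) (μ E) * cfc (fun t => √((1 + ψ t) / 2)) (μ E) =
      cfc (fun t => (1 + ψ t) / 2) (μ E) := by
    rw [← cfc_mul _ _ _ (by fun_prop) (by fun_prop)]
    refine cfc_congr fun t _ => ?_
    have := one_add_pos hψ t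
    exact Real.mul_self_sqrt (by positivity)
  have hhalf : (√2)⁻¹ * (√2)⁻¹ = (1 / 2 : ℝ) := by
    rw [← mul_inv, Real.mul_self_sqrt (by norm_num), one_div]
  rw [perturb, glue_apply]
  simp only [← ContinuousLinearMap.star_eq_adjoint]
  calc
    _ = (star (μ.coeff E ψ) * star (μ.innerWeight E ψ)) * μ (A ∩ E) *
          (μ.innerWeight E ψ * μ.coeff E ψ) +
        (star (μ.coeff E ψ) * star (μ.outerWeight E ψ)) * μ (A ∩ Eᶜ) *
          (μ.outerWeight E ψ * μ.coeff E ψ) := by noncomm_ring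
    _ = _ := by
      rw [hin, hin', hout, hout', mul_assoc, ← hcm.eq, ← mul_assoc, hsq,
        ← Algebra.commutes, ← mul_assoc, ← map_mul, hhalf, Algebra.smul_def]

/-- Each summand is affine in `ψ`, so the terms in `ψ` and `-ψ` cancel. -/
theorem isProperCStarCombination_perturb (μ : POVM X H) (hμ : μ.IsNormalized) {E : Set X}
    (hE : MeasurableSet E)
    (hcomm : ∀ A : Set X, MeasurableSet A → A ⊆ E → Commute (μ A) (μ E))
    (hc : Continuous ψ) (hψ : ∀ t, |ψ t| ≤ 1 / 2) :
    μ.IsProperCStarCombination ![μ.coeff E ψ, μ.coeff E (-ψ)]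
      ![μ.perturb hE ψ, μ.perturb hE (-ψ)] := by
  have hψ' : ∀ t, |(-ψ) t| ≤ 1 / 2 := fun t => by simpa using hψ t
  have h1 := cfc_const_one ℝ (μ E) (μ.isSelfAdjoint hE)
  constructor
  · simpa [Fin.forall_fin_two] using
      ⟨μ.isNormalized_perturb hμ hE hc hψ, μ.isNormalized_perturb hμ hE hc.neg hψ'⟩
  · simpa [Fin.forall_fin_two] using
      ⟨μ.isUnit_coeff hμ hE hc hψ, μ.isUnit_coeff hμ hE hc.neg hψ'⟩
  · simp only [Fin.sum_univ_two, Matrix.cons_val_zero, Matrix.cons_val_one]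
    rw [μ.adjoint_coeff_mul_coeff hμ hE hc hψ, μ.adjoint_coeff_mul_coeff hμ hE hc.neg hψ',
      ← cfc_add _ _ _ (by fun_prop) (by fun_prop), ← h1]
    refine cfc_congr fun t _ => ?_
    simp only [Pi.neg_apply]
    ring
  · intro A hA
    simp only [Fin.sum_univ_two, Matrix.cons_val_zero, Matrix.cons_val_one]
    rw [μ.adjoint_coeff_mul_perturb_mul_coeff hμ hE hcomm hc hψ hA,
      μ.adjoint_coeff_mul_perturb_mul_coeff hμ hE hcomm hc.neg hψ' hA, add_add_add_comm,
      ← add_mul, ← add_smul, ← cfc_add _ _ _ (by fun_prop) (by fun_prop)]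
    have h : cfc (fun t => (1 + ψ t) / 2 + (1 + (-ψ) t) / 2) (μ E) = 1 := by
      rw [← h1]
      refine cfc_congr fun t _ => ?_
      simp only [Pi.neg_apply]
      ring
    rw [h, one_mul, add_halves, one_smul, μ.apply_inter_add_inter_compl hA hE]

end perturbation

/-! ### A continuum of eigenvalues -/

/-- If `cfc f M` is unitarily conjugate to `M` and `f` is constant near a point of the spectrum,
then the value of `f` there is an eigenvalue of `M`. -/
theorem exists_eigenvector {M U : H →L[ℂ] H} (hM : IsSelfAdjoint M)
    (hU : U ∈ unitary (H →L[ℂ] H)) {f : ℝ → ℝ} (hf : ContinuousOn f (spectrum ℝ M))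
    (hfM : cfc f M = adjoint U * M * U) {t₀ c ε : ℝ} (hε : 0 < ε) (ht₀ : t₀ ∈ spectrum ℝ M)
    (hfc : ∀ t ∈ spectrum ℝ M, |t - t₀| < ε → f t = c) :
    ∃ v : H, v ≠ 0 ∧ M v = (c : ℂ) • v := by
  -- A bump at `t₀` vanishing where `f` may differ from `c`: `k(M)` is nonzero and its range
  -- consists of `c`-eigenvectors of `f(M)`, which `U` carries to those of `M`.
  set k : ℝ → ℝ := fun t => max 0 (1 - |t - t₀| / ε) with hk
  have hkc : Continuous k := by fun_prop
  have hk0 : cfc k M ≠ 0 := by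
    intro h0
    have h1 : k t₀ ∈ spectrum ℝ (cfc k M) := by
      rw [cfc_map_spectrum k M hM hkc.continuousOn]
      exact ⟨t₀, ht₀, rfl⟩
    rw [h0] at h1
    have : Nontrivial (H →L[ℂ] H) := by
      by_contra hn
      rw [not_nontrivial_iff_subsingleton] at hn
      simp [spectrum.of_subsingleton] at h1
    rw [spectrum.zero_eq] at h1
    simp [hk] at h1
  have hmul : cfc f M * cfc k M = (c : ℂ) • cfc k M := by
    have : (c : ℂ) • cfc k M = c • cfc k M := by ext; simp
    rw [this, ← cfc_smul c k M hkc.continuousOn, ← cfc_mul _ _ _ hf hkc.continuousOn]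
    refine cfc_congr fun t ht => ?_
    by_cases h : |t - t₀| < ε
    · simp [hfc t ht h]
    · have : k t = 0 := by
        rw [hk]
        refine max_eq_left ?_
        rw [sub_nonpos, one_le_div hε]
        exact not_lt.1 h
      simp [this]
  obtain ⟨v, hv⟩ : ∃ v, cfc k M v ≠ 0 := by
    by_contra! h
    exact hk0 (ContinuousLinearMap.ext h)
  have hUU : adjoint U * U = 1 := hU.1
  have hUU' : U * adjoint U = 1 := hU.2
  refine ⟨U (cfc k M v), fun h => hv ?_, ?_⟩
  · have := congrArg (fun T : H →L[ℂ] H => T (cfc k M v)) hUU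
    simpa [h] using this.symm
  · have h : M * U * cfc k M = (c : ℂ) • (U * cfc k M) := by
      calc M * U * cfc k M = (U * adjoint U) * (M * U * cfc k M) := by rw [hUU', one_mul]
        _ = U * ((adjoint U * M * U) * cfc k M) := by simp only [mul_assoc]
        _ = _ := by rw [← hfM, hmul, mul_smul_comm]
    exact congrArg (fun T : H →L[ℂ] H => T v) h

/-- Near every interior point `t₀` of the unit interval, every constant close to `t₀` is locally a
value of `t (1 + ψ t) / (1 + t ψ t)` for an admissible perturbation `ψ`. -/
theorem exists_perturbation {t₀ c : ℝ} (h0 : 0 < t₀) (h1 : t₀ < 1)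
    (hc : |c - t₀| < t₀ * (1 - t₀) / 8) :
    ∃ ψ : ℝ → ℝ, Continuous ψ ∧ (∀ t, |ψ t| ≤ 1 / 2) ∧ ∃ ε > 0, ∀ t ∈ Set.Icc (0 : ℝ) 1,
      |t - t₀| < ε → t * (1 + ψ t) / (1 + t * ψ t) = c := by
  have hcb := abs_lt.1 hc
  have hc1 : 1 - t₀ < 2 * (1 - c) := by nlinarith
  have hc1' : 0 < 1 - c := by linarith
  -- Solving `t (1 + ψ) / (1 + t ψ) = c` gives `ψ = (c - t) / (t (1 - c))`. The cutoff at `t₀ / 2`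
  -- avoids division by zero and the clamp enforces the bound; the radii `1/8` and `1/16` of `t₀ (1
  -- - t₀)` make both inactive near `t₀`.
  refine ⟨fun t => max (-(1 / 2)) (min (1 / 2) ((c - t) / (max t (t₀ / 2) * (1 - c)))), ?_, ?_,
    t₀ * (1 - t₀) / 16, by nlinarith [mul_pos h0 (sub_pos.2 h1)], ?_⟩
  · have : ∀ t, max t (t₀ / 2) * (1 - c) ≠ 0 := fun t =>
      (mul_pos (lt_max_of_lt_right (by linarith)) hc1').ne'
    fun_prop (disch := assumption)
  · intro t
    exact abs_le.2 ⟨le_max_left _ _, max_le (by norm_num) (min_le_left _ _)⟩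
  · intro t ht htt
    have htb := abs_lt.1 htt
    have ht2 : t₀ / 2 < t := by nlinarith
    have ht0 : 0 < t := by linarith
    have hpos : 0 < t * (1 - c) := mul_pos ht0 hc1'
    have hlow : t₀ * (1 - t₀) < 4 * (t * (1 - c)) := by nlinarith
    have hle : (c - t) / (t * (1 - c)) ≤ 1 / 2 := by
      rw [div_le_iff₀ hpos]; nlinarith
    have hge : -(1 / 2) ≤ (c - t) / (t * (1 - c)) := by
      rw [le_div_iff₀ hpos]; nlinarith
    simp only [max_eq_left ht2.le, min_eq_right hle, max_eq_right hge]
    have hD : 1 + t * ((c - t) / (t * (1 - c))) = (1 - t) / (1 - c) := by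
      field_simp; ring
    have hN : t * (1 + (c - t) / (t * (1 - c))) = c * ((1 - t) / (1 - c)) := by
      field_simp; ring
    have h1t : 1 - t ≠ 0 := by nlinarith
    rw [hD, hN, mul_div_assoc, div_self (div_ne_zero h1t hc1'.ne'), mul_one]

theorem IsCStarExtreme.isStarProjection [TopologicalSpace.SeparableSpace H] {μ : POVM X H}
    (hμ : μ.IsCStarExtreme) {E : Set X} (hE : MeasurableSet E)
    (hcomm : ∀ A : Set X, MeasurableSet A → A ⊆ E → Commute (μ A) (μ E)) :
    IsStarProjection (μ E) := by
  have hM := μ.isSelfAdjoint hE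
  have hn := hμ.isNormalized
  refine isStarProjection_iff_spectrum_subset_and_isSelfAdjoint.2 ⟨fun t₀ ht₀ => ?_, hM⟩
  by_contra hne
  simp only [Set.mem_insert_iff, Set.mem_singleton_iff, not_or] at hne
  have hmem := μ.spectrum_subset hn hE ht₀
  have h0 : 0 < t₀ := lt_of_le_of_ne hmem.1 (Ne.symm hne.1)
  have h1 : t₀ < 1 := lt_of_le_of_ne hmem.2 hne.2
  have hδ : 0 < t₀ * (1 - t₀) / 8 := by nlinarith [mul_pos h0 (sub_pos.2 h1)]
  have hsub : Metric.ball t₀ (t₀ * (1 - t₀) / 8) ⊆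
      {c : ℝ | ∃ v : H, v ≠ 0 ∧ μ E v = (c : ℂ) • v} := by
    intro c hc
    obtain ⟨ψ, hψc, hψ, ε, hε, hg⟩ := exists_perturbation h0 h1 hc
    obtain ⟨U, hU, hUE⟩ := hμ.unitarilyEquivalent 2 _ _
      (μ.isProperCStarCombination_perturb hn hE hcomm hψc hψ) 0
    have hUE' := hUE E hE
    rw [Matrix.cons_val_zero, μ.perturb_apply_self hn hE hψc hψ] at hUE'
    refine exists_eigenvector hM hU ?_ hUE' hε ht₀ fun t ht =>
      hg t (μ.spectrum_subset hn hE ht)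
    exact ContinuousOn.div (by fun_prop) (by fun_prop) fun t ht =>
      (one_add_mul_pos hψ (μ.spectrum_subset hn hE ht)).ne'
  -- The ball is an interval of positive length, hence uncountable.
  refine (Cardinal.Real.Ioo_countable_iff (x := t₀ - t₀ * (1 - t₀) / 8)
    (y := t₀ + t₀ * (1 - t₀) / 8)).not.2 (by linarith) ?_
  rw [← Real.ball_eq_Ioo]
  exact hM.countable_setOf_eigenvalue.mono hsub

end POVM

theorem mainTheorem1 {X : Type*} [MeasurableSpace X] {H : Type*} [NormedAddCommGroup H]
    [InnerProductSpace ℂ H] [CompleteSpace H] [TopologicalSpace.SeparableSpace H]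
    (μ : POVM X H) (hμ : μ.IsCStarExtreme) :
    (∀ E : Set X, MeasurableSet E →
      (∀ A : Set X, MeasurableSet A → A ⊆ E → Commute (μ A) (μ E)) →
        IsStarProjection (μ E)) ∧
    (∀ E : Set X, MeasurableSet E →
      (∀ B : Set X, MeasurableSet B → Commute (μ E) (μ B)) →
        IsStarProjection (μ E)) :=
  ⟨fun _ hE h => hμ.isStarProjection hE h,
    fun _ hE h => hμ.isStarProjection hE fun A hA _ => (h A hA).symm⟩
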